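/- **Theorem 4.** *Model.* Let $0\le s<1$ and $0<\gamma\le 1$, let $g=1/\gamma$ and $l=\max\{(1-s)/(3\sqrt2),\ \gamma/\sqrt2\}$. A network is a finite set $V$ of nodes in the Euclidean plane with pairwise distances at least $\gamma$; two nodes are neighbours if their distance lies in $(s,1]$, and the resulting graph is assumed connected, with (hop) diameter $D$. Time is divided into synchronous rounds, and all nodes are awake from the first round. In each round every node is a sender or a receiver. A node receives a packet in a round if and only if it is a receiver, exactly one of its neighbours sends (it receives what that neighbour sends), and no node within distance $s$ of it sends; otherwise it hears only noise, whatever the cause. A node knows $s$, $\gamma$, its own location and what it has heard, but not the network; in addition it is assumed that at any time each node knows which nodes of its own block (defined below) possess the source message $m$. Initially exactly one node, the source, possesses $m$. *Partition.* The plane is partitioned into a mesh of $3\times3$ squares (regions); each region, starting at its Northwest corner, into $\mu=\lceil 3/l\rceil^2$ blocks of size $l\times l$; and each block, starting at its Northwest corner, into $\nu=k^2$ homes of size $\gamma/\sqrt2\times\gamma/\sqrt2$, where $k=\lceil\sqrt2\,l/\gamma\rceil$ (the last blocks and homes of each row and column may be smaller). Every square contains its North and West borders and not its South and East borders. The blocks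 of a region, and the homes of a block, are numbered West to East, row by row, North to South, and the label of a node is the pair (block number, home number). *Algorithm $\mathcal B^2$.* First, neighbourhood discovery $\mathcal D^*$, where each node $u$ keeps a set $N_u$ of labels, initially empty. (i) Procedure $\mathcal D$: for each of the $\mu\nu$ labels $x$ in turn there is one round, in which the nodes with label $x$ send a hello, and every other node $u$ that hears a hello adds $x$ to $N_u$. (ii) For each label $y$, Procedure $\mathcal D_y$: for each label $x$ in turn there is one round, in which the nodes with label $x$ or $y$ send a hello, and every other node $u$ that hears no hello and has $y\in N_u$ adds $x$ to $N_u$. Next, transmission $\mathcal T^2$, in parallel in all regions: an iteration gives each of the $\mu$ block numbers in turn one phase. At the beginning of a phase the spokesmen of each block with this number are determined from the nodes of the block that then possess $m$: they are, for each row, each column and each diagonal (in both directions) of homes of the block, the two such nodes in the homes closest to the two ends of that row, column or diagonal. The phase has one round for every row and end ($E_i,W_i$ for $i=1,\dots,k$), then one for every column and end ($N_i,S_i$ for $i=1,\dots,k$), then one for every diagonal and end ($NE_i,SE_i,NW_i,SW_i$ for $i=1,\dots,2k-1$); in each of these rounds the corresponding spokesman sends $m$, unless it has already sent $m$ before. All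 other nodes listen, and a node that receives $m$ possesses it from then on. Iterations are repeated until no node has transmitted during an iteration; then the algorithm ends. *Claim.* There is an absolute constant $C>0$ such that, for all $s$, $\gamma$, all such connected networks and all sources, Algorithm $\mathcal B^2$ ends, every node possesses $m$ when it ends, and the total number of rounds is at most $$C\left(\frac{D\,g}{l}+g^4\right).$$ -/

import Mathlib

/-! # Broadcasting in the plane under the swamping communication model -/

noncomputable section

namespace Swamping

/-- The Euclidean plane. Coordinate `0` points East, coordinate `1` points North. -/
abbrev Plane : Type := EuclideanSpace ℝ (Fin 2)

/-! ## The communication model -/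

/-- The network on a finite set `V` of nodes (a node is its location): two nodes are neighbours when
their distance is greater than the swamping distance `s` and at most `1`. -/
def network (s : ℝ) (V : Finset Plane) : SimpleGraph V where
  Adj u v := u ≠ v ∧ s < dist (u : Plane) v ∧ dist (u : Plane) v ≤ 1
  symm := ⟨fun u v h => ⟨h.1.symm, by rw [dist_comm]; exact h.2⟩⟩
  loopless := ⟨fun _ h => h.1 rfl⟩

/-- In a round in which node `w` transmits `tx w` (`none`: `w` is a receiver), node `v` receives the
packet `p`: `v` is a receiver, no node within distance `s` of `v` transmits, and exactly one
neighbour of `v` transmits, and it transmits `p`. -/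
def Receives {P : Type*} (s : ℝ) {V : Finset Plane} (tx : V → Option P) (v : V) (p : P) : Prop :=
  tx v = none ∧
  (∀ w : V, dist (w : Plane) v ≤ s → tx w = none) ∧
  ∃ u : V, (network s V).Adj u v ∧ tx u = some p ∧
    ∀ w : V, (network s V).Adj w v → tx w ≠ none → w = u

open Classical in
/-- What `v` hears in a round: a packet, or `none`, i.e. noise (silence, collision and swamping
are indistinguishable). -/
def heard {P : Type*} (s : ℝ) {V : Finset Plane} (tx : V → Option P) (v : V) : Option P :=
  if h : ∃ p, Receives s tx v p then some h.choose else none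

/-- A deterministic synchronous local algorithm for broadcasting a message of type `M`.  All
components are functions of the round number, the node's own location, its own state, and the
side information of type `I` that the node has in that round; the network is not available. -/
structure LocalAlgorithm (M I σ P : Type*) where
  /-- initial state, from the location and the source message (`none` at nodes not the source) -/
  init : Plane → Option M → σ
  /-- local computation at the beginning of a round -/
  update : ℕ → Plane → I → σ → σ
  /-- the packet transmitted in this round, or `none` to be a receiver -/
  send : ℕ → Plane → σ → Option P
  /-- local computation at the end of a round, from what was heard -/
  listen : ℕ → Plane → σ → Option P → σ

section Execution

variable {M I σ P : Type*} (A : LocalAlgorithm M I σ P) (s : ℝ) {V : Finset Plane}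
  (info : (V → σ) → V → I)

/-- The local states in round `t` after the `update` computation, from the states `st` at the
beginning of the round. -/
def updated (t : ℕ) (st : V → σ) : V → σ := fun u => A.update t u (info st u) (st u)

/-- The transmissions of round `t`, from the states `st` at the beginning of the round. -/
def transmissions (t : ℕ) (st : V → σ) : V → Option P :=
  fun u => A.send t u (updated A info t st u)

open Classical in
/-- The states at the beginning of round `t` (after `t` complete rounds), when `src` broadcasts `m`.
All nodes are awake from round `0` on. -/
def states (src : V) (m : M) : ℕ → V → σ
  | 0 => fun u => A.init u (if u = src then some m else none)
  | t + 1 => fun u =>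
      A.listen t u (updated A info t (states src m t) u)
        (heard s (transmissions A info t (states src m t)) u)

end Execution

/-! ## The partition of the plane

Regions are `3 × 3` squares, blocks are `l × l` squares in a region, homes are
`γ/√2 × γ/√2` squares in a block (the last ones in each row and column are cut off).
All squares contain their North and West borders and not their South and East borders, so
positions are measured eastwards and southwards, and the same one-dimensional half-open partition is
used in both directions. Rows are counted southwards, columns eastwards, all labels from `0`. -/

/-- The block length `l`. -/
def blockLen (s γ : ℝ) : ℝ := max ((1 - s) / (3 * √2)) (γ / √2)

/-- Eastward coordinate. -/
def east (p : Plane) : ℝ := p 0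

/-- Southward coordinate. -/
def south (p : Plane) : ℝ := -(p 1)

/-- Index of the region interval `[3i, 3i+3)` of `z`. -/
def regionIdx (z : ℝ) : ℤ := ⌊z / 3⌋

/-- Offset of `z` in its region interval. -/
def regionOff (z : ℝ) : ℝ := z - 3 * regionIdx z

/-- Index of the block interval of `z` in its region interval. -/
def blockIdx (s γ z : ℝ) : ℕ := ⌊regionOff z / blockLen s γ⌋₊

/-- Offset of `z` in its block interval. -/
def blockOff (s γ z : ℝ) : ℝ := regionOff z - blockLen s γ * blockIdx s γ z

/-- Index of the home interval of `z` in its block interval. -/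
def homeIdx (s γ z : ℝ) : ℕ := ⌊blockOff s γ z / (γ / √2)⌋₊

/-- Number of rows (and of columns) of blocks in a region. -/
def blockRows (s γ : ℝ) : ℕ := ⌈3 / blockLen s γ⌉₊

/-- Number of rows (and of columns) of homes in a block. -/
def homeRows (s γ : ℝ) : ℕ := ⌈√2 * blockLen s γ / γ⌉₊

/-- Number `μ` of blocks in a region. -/
def numBlocks (s γ : ℝ) : ℕ := blockRows s γ ^ 2

/-- Number `ν` of homes in a block. -/
def numHomes (s γ : ℝ) : ℕ := homeRows s γ ^ 2

/-- Label of the block of `p` in its region: West to East, row by row, North to South. -/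
def blockLabel (s γ : ℝ) (p : Plane) : ℕ :=
  blockIdx s γ (south p) * blockRows s γ + blockIdx s γ (east p)

/-- Row of the home of `p` in its block. -/
def homeRow (s γ : ℝ) (p : Plane) : ℕ := homeIdx s γ (south p)

/-- Column of the home of `p` in its block. -/
def homeCol (s γ : ℝ) (p : Plane) : ℕ := homeIdx s γ (east p)

/-- Label of the home of `p` in its block: West to East, row by row, North to South. -/
def homeLabel (s γ : ℝ) (p : Plane) : ℕ := homeRow s γ p * homeRows s γ + homeCol s γ p

/-- The (block, home) label of `p`. -/
def label (s γ : ℝ) (p : Plane) : ℕ × ℕ := (blockLabel s γ p, homeLabel s γ p)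

/-- `p` and `q` lie in the same block of the same region. -/
def SameBlock (s γ : ℝ) (p q : Plane) : Prop :=
  regionIdx (east p) = regionIdx (east q) ∧ regionIdx (south p) = regionIdx (south q) ∧
  blockIdx s γ (east p) = blockIdx s γ (east q) ∧ blockIdx s γ (south p) = blockIdx s γ (south q)

/-! ## Spokesmen -/

/-- Spokesman labels: `E`, `W` by row, `N`, `S` by column, `NE`, `SW` by Southwest-Northeast
diagonal, `SE`, `NW` by Southeast-Northwest diagonal. -/
inductive Role where
  | E (i : ℕ) | W (i : ℕ) | N (i : ℕ) | S (i : ℕ)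
  | NE (i : ℕ) | SE (i : ℕ) | NW (i : ℕ) | SW (i : ℕ)

/-- Index of the Southwest-Northeast diagonal of homes through the home of `p`. -/
def antiDiag (s γ : ℝ) (p : Plane) : ℕ := homeRow s γ p + homeCol s γ p

/-- Index of the Southeast-Northwest diagonal of homes through the home of `p`; as
`homeRow s γ p < homeRows s γ`, the subtraction is not truncated. -/
def mainDiag (s γ : ℝ) (p : Plane) : ℕ := homeCol s γ p + (homeRows s γ - 1 - homeRow s γ p)

/-- Given the set `K` of the nodes of a block that possess the message, `p` is the spokesman
of the block for the given role: it is in `K` and, among the nodes of `K` in the same line of homes,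
in the home closest to the given end of the line. -/
def IsSpokesman (s γ : ℝ) (K : Set Plane) (p : Plane) : Role → Prop
  | .E i => p ∈ K ∧ homeRow s γ p = i ∧
      ∀ q ∈ K, homeRow s γ q = i → homeCol s γ q ≤ homeCol s γ p
  | .W i => p ∈ K ∧ homeRow s γ p = i ∧
      ∀ q ∈ K, homeRow s γ q = i → homeCol s γ p ≤ homeCol s γ q
  | .N i => p ∈ K ∧ homeCol s γ p = i ∧
      ∀ q ∈ K, homeCol s γ q = i → homeRow s γ p ≤ homeRow s γ q
  | .S i => p ∈ K ∧ homeCol s γ p = i ∧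
      ∀ q ∈ K, homeCol s γ q = i → homeRow s γ q ≤ homeRow s γ p
  | .NE i => p ∈ K ∧ antiDiag s γ p = i ∧
      ∀ q ∈ K, antiDiag s γ q = i → homeCol s γ q ≤ homeCol s γ p
  | .SW i => p ∈ K ∧ antiDiag s γ p = i ∧
      ∀ q ∈ K, antiDiag s γ q = i → homeCol s γ p ≤ homeCol s γ q
  | .SE i => p ∈ K ∧ mainDiag s γ p = i ∧
      ∀ q ∈ K, mainDiag s γ q = i → homeCol s γ q ≤ homeCol s γ p
  | .NW i => p ∈ K ∧ mainDiag s γ p = i ∧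
      ∀ q ∈ K, mainDiag s γ q = i → homeCol s γ p ≤ homeCol s γ q

/-- The order in which the spokesmen of a block with `k` rows of homes have their turns. -/
def turns (k : ℕ) : List Role :=
  (List.range k).flatMap (fun i => [.E i, .W i]) ++
  (List.range k).flatMap (fun i => [.N i, .S i]) ++
  (List.range (2 * k - 1)).flatMap (fun i => [.NE i, .SE i, .NW i, .SW i])

/-! ## Algorithm `B²` -/

/-- What has to be done in a round. -/
inductive Task where
  /-- Neighbourhood discovery, first part (Procedure `D`): the turn of the label `x`. -/
  | hello (x : ℕ × ℕ)
  /-- Neighbourhood discovery by collisions (Procedure `D_y`): the turn of the label `x`. -/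
  | probe (y x : ℕ × ℕ)
  /-- Transmission of the message (Procedure `T²`): the given turn of the given block. -/
  | relay (block turn : ℕ)

/-- The `i`-th (block, home) label in the order of two nested loops over blocks and homes. -/
def nthLabel (s γ : ℝ) (i : ℕ) : ℕ × ℕ := (i / numHomes s γ, i % numHomes s γ)

/-- Number of (block, home) labels. -/
def numLabels (s γ : ℝ) : ℕ := numBlocks s γ * numHomes s γ

/-- Number of rounds of the neighbourhood discovery `D*`: one execution of `D` and one of
`D_y` for every label `y`. -/
def discoveryTime (s γ : ℝ) : ℕ := numLabels s γ + numLabels s γ * numLabels s γ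

/-- Number of rounds that a block gets in an iteration of `T²`. -/
def numTurns (s γ : ℝ) : ℕ := (turns (homeRows s γ)).length

/-- Number of rounds of an iteration of the loop of `T²`. -/
def iterationTime (s γ : ℝ) : ℕ := numBlocks s γ * numTurns s γ

/-- The schedule of Algorithm `B²`: first `D*`, then the iterations of `T²`. -/
def task (s γ : ℝ) (t : ℕ) : Task :=
  if t < numLabels s γ then
    .hello (nthLabel s γ t)
  else if t < discoveryTime s γ then
    .probe (nthLabel s γ ((t - numLabels s γ) / numLabels s γ))
      (nthLabel s γ ((t - numLabels s γ) % numLabels s γ))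
  else
    .relay ((t - discoveryTime s γ) / numTurns s γ % numBlocks s γ)
      ((t - discoveryTime s γ) % numTurns s γ)

/-- Transmitted packets: a `hello`, or the message. -/
inductive Packet (M : Type*) where
  | hello
  | message (m : M)

/-- The local state of a node `u`. -/
structure NodeState (M : Type*) where
  /-- the set `N_u` of the labels of nodes known to `u` -/
  known : Set (ℕ × ℕ)
  /-- the source message, if `u` possesses it -/
  msg : Option M
  /-- the nodes of the own block that possessed the message when the spokesman status was last
  updated -/
  holders : Set Plane
  /-- whether `u` has sent the message -/
  sent : Bool

open Classical in
/-- The packet that a node at `p` with state `a` transmits for a given task. -/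
def sendTask {M : Type*} (s γ : ℝ) (p : Plane) (a : NodeState M) : Task → Option (Packet M)
  | .hello x => if label s γ p = x then some .hello else none
  | .probe y x => if label s γ p = x ∨ label s γ p = y then some .hello else none
  | .relay block turn =>
      if blockLabel s γ p = block ∧ a.sent = false ∧
          ∃ r, (turns (homeRows s γ))[turn]? = some r ∧ IsSpokesman s γ a.holders p r then
        a.msg.map .message
      else none

/-- The spokesman status is updated, from the information which nodes of the own block possess the
message, at the beginning of the turns of each block. -/
def updateTask {M : Type*} (info : Set Plane) (a : NodeState M) : Task → NodeState M
  | .relay _ 0 => { a with holders := info }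
  | _ => a

open Classical in
/-- The new state of a node at `p` with state `a` that has heard `h` during the given task. -/
def listenTask {M : Type*} (s γ : ℝ) (p : Plane) (a : NodeState M) (h : Option (Packet M)) :
    Task → NodeState M
  | .hello x =>
      if label s γ p ≠ x ∧ h = some .hello then { a with known := insert x a.known } else a
  | .probe y x =>
      if ¬ (label s γ p = x ∨ label s γ p = y) ∧ h ≠ some .hello ∧ y ∈ a.known then
        { a with known := insert x a.known }
      else a
  | .relay block turn =>
      { a with
        msg := match h with
          | some (.message m) => some m
          | _ => a.msg
        sent := a.sent || (sendTask s γ p a (.relay block turn)).isSome }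

/-- Algorithm `B²`, with the knowledge of the nodes of the own block that possess the message
as side information. -/
def algorithmB2 (M : Type*) (s γ : ℝ) :
    LocalAlgorithm M (Set Plane) (NodeState M) (Packet M) where
  init _ m := { known := ∅, msg := m, holders := ∅, sent := false }
  update t _ info a := updateTask info a (task s γ t)
  send t p a := sendTask s γ p a (task s γ t)
  listen t p a h := listenTask s γ p a h (task s γ t)

/-- The side information: the nodes of the block of `u` that currently possess the message. -/
def blockHolders {M : Type*} (s γ : ℝ) {V : Finset Plane} (st : V → NodeState M) (u : V) :
    Set Plane :=
  {p | ∃ w : V, (w : Plane) = p ∧ SameBlock s γ w u ∧ (st w).msg ≠ none}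

section

variable {M : Type*} (s γ : ℝ) {V : Finset Plane} (src : V) (m : M)

/-- The states of the nodes after `t` rounds of Algorithm `B²`. -/
def statesB2 (t : ℕ) : V → NodeState M :=
  states (algorithmB2 M s γ) s (blockHolders s γ) src m t

/-- Node `u` transmits in round `t` of Algorithm `B²`. -/
def TransmitsB2 (t : ℕ) (u : V) : Prop :=
  transmissions (algorithmB2 M s γ) (blockHolders s γ) t (statesB2 s γ src m t) u ≠ none

/-- No node transmits in iteration `j` of the loop of `T²`. -/
def SilentIteration (j : ℕ) : Prop :=
  ∀ i < iterationTime s γ, ∀ u : V,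
    ¬ TransmitsB2 s γ src m (discoveryTime s γ + j * iterationTime s γ + i) u

/-- Algorithm `B²` ends after exactly `T` rounds: the loop of `T²` is repeated until no node has
transmitted in an iteration. -/
def EndsAt (T : ℕ) : Prop :=
  ∃ j, SilentIteration s γ src m j ∧ (∀ i < j, ¬ SilentIteration s γ src m i) ∧
    T = discoveryTime s γ + (j + 1) * iterationTime s γ

end

end Swamping

end

/-! Transmitters of the same round belong to blocks with the same number. Different blocks with the
same number are more than `2` apart, and a block has only one spokesman for each role, so packets
never collide and each transmission of the message reaches all neighbours of its sender.

The spokesmen reach all neighbours of all possessors of the message in their block. Let `v` be a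
neighbour of such a possessor `u`, and suppose that it is too far from `u` to be swamped by another
node of the block, or else so close that all nodes of the block are within its range. One of the
eight compass directions deviates by at most `arctan (1 / 2)` from the direction of `v` (or from
the opposite direction, in the second case), and the last possessor on the line of homes through
`u` in this direction deviates from it by at most `π / 4`. These angles add up to less than a right
angle, and blocks are small, so moving from `u` to this spokesman does not increase (does not
decrease) the distance to `v`, and the spokesman is a neighbour of `v` as well.

Hence the message advances by one hop in each iteration. Once all nodes possess it, the spokesmen
do not change any more, have all sent after one more iteration, and remain silent from then on.
Conversely, possession cannot spread in a silent iteration, so then the possessors are closed under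
adjacency and connectedness makes them all the nodes. -/

namespace Swamping

open scoped InnerProductSpace

/-! ## The plane -/

section Plane

@[simp] theorem east_sub (p q : Plane) : east (p - q) = east p - east q := rfl

@[simp] theorem south_sub (p q : Plane) : south (p - q) = south p - south q := by
  simp [south]; ring

theorem inner_eq_east_mul_add_south_mul (v t : Plane) :
    ⟪v, t⟫_ℝ = east v * east t + south v * south t := by
  simp [PiLp.inner_apply, Fin.sum_univ_two, east, south, mul_comm]

theorem norm_sq_eq_east_sq_add_south_sq (v : Plane) : ‖v‖ ^ 2 = east v ^ 2 + south v ^ 2 := by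
  rw [← real_inner_self_eq_norm_sq, inner_eq_east_mul_add_south_mul]; ring

theorem abs_east_sub_le_dist (p q : Plane) : |east p - east q| ≤ dist p q := by
  rw [← east_sub, dist_eq_norm]
  exact PiLp.norm_apply_le (p - q) 0

theorem abs_south_sub_le_dist (p q : Plane) : |south p - south q| ≤ dist p q := by
  rw [← south_sub, dist_eq_norm, south, abs_neg]
  exact PiLp.norm_apply_le (p - q) 1

theorem dist_lt_sqrt_two_mul {p q : Plane} {c : ℝ} (he : |east p - east q| < c)
    (hs : |south p - south q| < c) : dist p q < √2 * c := by
  have hc : 0 < c := (abs_nonneg _).trans_lt he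
  refine lt_of_pow_lt_pow_left₀ 2 (by positivity) ?_
  calc dist p q ^ 2 = (east p - east q) ^ 2 + (south p - south q) ^ 2 := by
        rw [dist_eq_norm, norm_sq_eq_east_sq_add_south_sq, east_sub, south_sub]
    _ < c ^ 2 + c ^ 2 :=
        add_lt_add (sq_lt_sq.2 (he.trans_le (le_abs_self c)))
          (sq_lt_sq.2 (hs.trans_le (le_abs_self c)))
    _ = (√2 * c) ^ 2 := by rw [mul_pow, Real.sq_sqrt zero_le_two]; ring

end Plane

section InnerProductSpace

variable {E : Type*} [NormedAddCommGroup E] [InnerProductSpace ℝ E] {v t : E}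

theorem norm_le_norm_add_of_inner_nonneg (h : 0 ≤ ⟪v, t⟫_ℝ) : ‖t‖ ≤ ‖v + t‖ := by
  refine le_of_sq_le_sq ?_ (norm_nonneg _)
  rw [norm_add_sq_real]
  linarith [sq_nonneg ‖v‖]

theorem norm_sub_le_of_norm_sq_le_two_mul_inner (h : ‖v‖ ^ 2 ≤ 2 * ⟪v, t⟫_ℝ) :
    ‖t - v‖ ≤ ‖t‖ := by
  refine le_of_sq_le_sq ?_ (norm_nonneg _)
  rw [norm_sub_sq_real, real_inner_comm]
  linarith

end InnerProductSpace

/-! ## Blocks and homes -/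

section Interval

variable {s γ z z' : ℝ}

theorem blockLen_pos (s : ℝ) (hγ : 0 < γ) : 0 < blockLen s γ :=
  lt_max_of_lt_right (by positivity)

theorem blockLen_lt_one (hs : 0 ≤ s) (hγ1 : γ ≤ 1) : blockLen s γ < 1 := by
  have h2 : (1 : ℝ) < √2 := by rw [Real.lt_sqrt] <;> norm_num
  refine max_lt ?_ ?_ <;> rw [div_lt_one (by positivity)] <;> linarith

theorem sqrt_two_mul_blockLen (s γ : ℝ) : √2 * blockLen s γ = max ((1 - s) / 3) γ := by
  rw [blockLen, mul_max_of_nonneg _ _ (Real.sqrt_nonneg 2)]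
  congr 1 <;> field_simp

theorem floor_div_mul_le {c : ℝ} (hc : 0 < c) (hz : 0 ≤ z) : ⌊z / c⌋₊ * c ≤ z :=
  (le_div_iff₀ hc).1 (Nat.floor_le (div_nonneg hz hc.le))

theorem lt_floor_div_add_one_mul {c : ℝ} (hc : 0 < c) (z : ℝ) : z < (⌊z / c⌋₊ + 1) * c :=
  (div_lt_iff₀ hc).1 (Nat.lt_floor_add_one _)

theorem regionOff_nonneg (z : ℝ) : 0 ≤ regionOff z := by
  simpa [regionOff, regionIdx, mul_comm] using Int.sub_floor_div_mul_nonneg z three_pos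

theorem regionOff_lt (z : ℝ) : regionOff z < 3 := by
  simpa [regionOff, regionIdx, mul_comm] using Int.sub_floor_div_mul_lt z three_pos

theorem blockOff_nonneg (s z : ℝ) (hγ : 0 < γ) : 0 ≤ blockOff s γ z := by
  have := floor_div_mul_le (blockLen_pos s hγ) (regionOff_nonneg z)
  unfold blockOff blockIdx
  linarith

theorem blockOff_lt (s z : ℝ) (hγ : 0 < γ) : blockOff s γ z < blockLen s γ := by
  have := lt_floor_div_add_one_mul (blockLen_pos s hγ) (regionOff z)
  unfold blockOff blockIdx
  linarith

theorem homeIdx_mul_le_blockOff (s z : ℝ) (hγ : 0 < γ) :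
    homeIdx s γ z * (γ / √2) ≤ blockOff s γ z :=
  floor_div_mul_le (by positivity) (blockOff_nonneg s z hγ)

theorem blockOff_lt_homeIdx_add_one_mul (s z : ℝ) (hγ : 0 < γ) :
    blockOff s γ z < (homeIdx s γ z + 1) * (γ / √2) :=
  lt_floor_div_add_one_mul (by positivity) _

theorem blockIdx_lt_blockRows (s z : ℝ) (hγ : 0 < γ) : blockIdx s γ z < blockRows s γ := by
  have hl := blockLen_pos s hγ
  refine (Nat.floor_lt (div_nonneg (regionOff_nonneg z) hl.le)).2 ?_
  calc regionOff z / blockLen s γ < 3 / blockLen s γ := by gcongr; exact regionOff_lt z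
    _ ≤ blockRows s γ := Nat.le_ceil _

theorem homeIdx_lt_homeRows (s z : ℝ) (hγ : 0 < γ) : homeIdx s γ z < homeRows s γ := by
  refine (Nat.floor_lt (div_nonneg (blockOff_nonneg s z hγ) (by positivity))).2 ?_
  calc blockOff s γ z / (γ / √2) < blockLen s γ / (γ / √2) := by
        gcongr; exact blockOff_lt s z hγ
    _ = √2 * blockLen s γ / γ := by field_simp
    _ ≤ homeRows s γ := Nat.le_ceil _

theorem homeRows_pos (s : ℝ) (hγ : 0 < γ) : 0 < homeRows s γ :=
  (Nat.zero_le _).trans_lt (homeIdx_lt_homeRows s 0 hγ)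

/-- `z` and `z'` lie in the same interval of the one-dimensional partition into blocks. -/
def SameInterval (s γ z z' : ℝ) : Prop :=
  regionIdx z = regionIdx z' ∧ blockIdx s γ z = blockIdx s γ z'

theorem SameInterval.sub_eq (h : SameInterval s γ z z') :
    z - z' = blockOff s γ z - blockOff s γ z' := by
  simp only [blockOff, regionOff, h.1, h.2]; ring

theorem SameInterval.abs_sub_lt_blockLen (hγ : 0 < γ) (h : SameInterval s γ z z') :
    |z - z'| < blockLen s γ := by
  rw [h.sub_eq]
  exact abs_sub_lt_of_nonneg_of_lt (blockOff_nonneg s z hγ) (blockOff_lt s z hγ)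
    (blockOff_nonneg s z' hγ) (blockOff_lt s z' hγ)

theorem SameInterval.abs_sub_lt_of_homeIdx_eq (hγ : 0 < γ) (h : SameInterval s γ z z')
    (hh : homeIdx s γ z = homeIdx s γ z') : |z - z'| < γ / √2 := by
  have hz := blockOff_lt_homeIdx_add_one_mul s z hγ
  have hz' := homeIdx_mul_le_blockOff s z hγ
  rw [hh] at hz hz'
  rw [h.sub_eq, abs_sub_lt_iff]
  constructor <;>
    linarith [blockOff_lt_homeIdx_add_one_mul s z' hγ, homeIdx_mul_le_blockOff s z' hγ]

theorem SameInterval.lt_of_homeIdx_lt (hγ : 0 < γ) (h : SameInterval s γ z z')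
    (hh : homeIdx s γ z < homeIdx s γ z') : z < z' := by
  have hidx : (homeIdx s γ z + 1 : ℝ) ≤ homeIdx s γ z' := by exact_mod_cast hh
  have hoff : blockOff s γ z < blockOff s γ z' :=
    calc blockOff s γ z < (homeIdx s γ z + 1) * (γ / √2) := blockOff_lt_homeIdx_add_one_mul s z hγ
      _ ≤ homeIdx s γ z' * (γ / √2) := by gcongr
      _ ≤ blockOff s γ z' := homeIdx_mul_le_blockOff s z' hγ
  linarith [h.sub_eq]

theorem three_sub_blockLen_lt_abs_sub (hγ : 0 < γ) (hr : regionIdx z ≠ regionIdx z')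
    (hb : blockIdx s γ z = blockIdx s γ z') : 3 - blockLen s γ < |z - z'| := by
  have hsub : z - z' = 3 * (regionIdx z - regionIdx z' : ℤ) +
      (blockOff s γ z - blockOff s γ z') := by
    simp only [blockOff, regionOff, hb]; push_cast; ring
  have hoff : |blockOff s γ z - blockOff s γ z'| < blockLen s γ :=
    abs_sub_lt_of_nonneg_of_lt (blockOff_nonneg s z hγ) (blockOff_lt s z hγ)
      (blockOff_nonneg s z' hγ) (blockOff_lt s z' hγ)
  have hregion : (1 : ℝ) ≤ |((regionIdx z - regionIdx z' : ℤ) : ℝ)| := by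
    exact_mod_cast Int.one_le_abs (sub_ne_zero.2 hr)
  have htri := abs_sub_abs_le_abs_add (3 * ((regionIdx z - regionIdx z' : ℤ) : ℝ))
    (blockOff s γ z - blockOff s γ z')
  rw [← hsub, abs_mul, abs_of_pos three_pos] at htri
  linarith

end Interval

section Block

variable {s γ : ℝ} {p q : Plane}

theorem blockLabel_lt_numBlocks (s : ℝ) (hγ : 0 < γ) (p : Plane) :
    blockLabel s γ p < numBlocks s γ := by
  have hrow := blockIdx_lt_blockRows s (south p) hγ
  have hcol := blockIdx_lt_blockRows s (east p) hγ
  unfold blockLabel numBlocks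
  nlinarith

theorem blockIdx_eq_of_blockLabel_eq (hγ : 0 < γ) (h : blockLabel s γ p = blockLabel s γ q) :
    blockIdx s γ (east p) = blockIdx s γ (east q) ∧
      blockIdx s γ (south p) = blockIdx s γ (south q) := by
  have hp := blockIdx_lt_blockRows s (east p) hγ
  have hq := blockIdx_lt_blockRows s (east q) hγ
  have hpos : 0 < blockRows s γ := (Nat.zero_le _).trans_lt hp
  constructor
  · simpa [blockLabel, Nat.mul_add_mod_self_right, Nat.mod_eq_of_lt, hp, hq] using
      congrArg (· % blockRows s γ) h
  · simpa [blockLabel, Nat.add_div_of_dvd_right, Nat.div_eq_of_lt, hp, hq, hpos] using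
      congrArg (· / blockRows s γ) h

theorem homeRow_lt_homeRows (s : ℝ) (hγ : 0 < γ) (p : Plane) : homeRow s γ p < homeRows s γ :=
  homeIdx_lt_homeRows s _ hγ

theorem homeCol_lt_homeRows (s : ℝ) (hγ : 0 < γ) (p : Plane) : homeCol s γ p < homeRows s γ :=
  homeIdx_lt_homeRows s _ hγ

namespace SameBlock

theorem refl (s γ : ℝ) (p : Plane) : SameBlock s γ p p := ⟨rfl, rfl, rfl, rfl⟩

theorem symm (h : SameBlock s γ p q) : SameBlock s γ q p :=
  ⟨h.1.symm, h.2.1.symm, h.2.2.1.symm, h.2.2.2.symm⟩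

theorem trans {r : Plane} (h : SameBlock s γ p q) (h' : SameBlock s γ q r) : SameBlock s γ p r :=
  ⟨h.1.trans h'.1, h.2.1.trans h'.2.1, h.2.2.1.trans h'.2.2.1, h.2.2.2.trans h'.2.2.2⟩

theorem sameInterval_east (h : SameBlock s γ p q) : SameInterval s γ (east p) (east q) :=
  ⟨h.1, h.2.2.1⟩

theorem sameInterval_south (h : SameBlock s γ p q) : SameInterval s γ (south p) (south q) :=
  ⟨h.2.1, h.2.2.2⟩

theorem blockLabel_eq (h : SameBlock s γ p q) : blockLabel s γ p = blockLabel s γ q := by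
  rw [blockLabel, blockLabel, h.2.2.1, h.2.2.2]

theorem dist_lt (hγ : 0 < γ) (h : SameBlock s γ p q) : dist p q < √2 * blockLen s γ :=
  dist_lt_sqrt_two_mul (h.sameInterval_east.abs_sub_lt_blockLen hγ)
    (h.sameInterval_south.abs_sub_lt_blockLen hγ)

theorem dist_lt_of_home_eq (hγ : 0 < γ) (h : SameBlock s γ p q)
    (hr : homeRow s γ p = homeRow s γ q) (hc : homeCol s γ p = homeCol s γ q) :
    dist p q < γ :=
  calc dist p q < √2 * (γ / √2) :=
        dist_lt_sqrt_two_mul (h.sameInterval_east.abs_sub_lt_of_homeIdx_eq hγ hc)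
          (h.sameInterval_south.abs_sub_lt_of_homeIdx_eq hγ hr)
    _ = γ := by field_simp

theorem abs_south_sub_lt_of_homeRow_eq (hγ : 0 < γ) (h : SameBlock s γ p q) (hd : γ ≤ dist p q)
    (hr : homeRow s γ p = homeRow s γ q) : |south p - south q| < |east p - east q| := by
  by_contra! hle
  have hsouth := h.sameInterval_south.abs_sub_lt_of_homeIdx_eq hγ hr
  refine hd.not_gt ?_
  calc dist p q < √2 * (γ / √2) := dist_lt_sqrt_two_mul (hle.trans_lt hsouth) hsouth
    _ = γ := by field_simp

theorem abs_east_sub_lt_of_homeCol_eq (hγ : 0 < γ) (h : SameBlock s γ p q) (hd : γ ≤ dist p q)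
    (hc : homeCol s γ p = homeCol s γ q) : |east p - east q| < |south p - south q| := by
  by_contra! hle
  have heast := h.sameInterval_east.abs_sub_lt_of_homeIdx_eq hγ hc
  refine hd.not_gt ?_
  calc dist p q < √2 * (γ / √2) := dist_lt_sqrt_two_mul heast (hle.trans_lt heast)
    _ = γ := by field_simp

end SameBlock

theorem sameBlock_of_dist_le_two (hs : 0 ≤ s) (hγ : 0 < γ) (hγ1 : γ ≤ 1)
    (h : blockLabel s γ p = blockLabel s γ q) (hd : dist p q ≤ 2) : SameBlock s γ p q := by
  obtain ⟨hcol, hrow⟩ := blockIdx_eq_of_blockLabel_eq hγ h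
  have hl := blockLen_lt_one hs hγ1
  refine ⟨?_, ?_, hcol, hrow⟩ <;> by_contra hne
  · linarith [three_sub_blockLen_lt_abs_sub hγ hne hcol, abs_east_sub_le_dist p q]
  · linarith [three_sub_blockLen_lt_abs_sub hγ hne hrow, abs_south_sub_le_dist p q]

end Block

/-! ## Spokesmen -/

/-- The end of a line of homes: the rows end at `E` and `W`, the columns at `N` and `S`, the
Southwest-Northeast diagonals at `NE` and `SW`, the others at `SE` and `NW`. -/
inductive Compass where
  | E | W | N | S | NE | SE | NW | SW

namespace Compass

/-- The role of the spokesman at the end `d` of the `i`-th line. -/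
def role : Compass → ℕ → Role
  | E => .E | W => .W | N => .N | S => .S | NE => .NE | SE => .SE | NW => .NW | SW => .SW

/-- Index of the line with an end at `d` through the home of a node. -/
noncomputable def line (s γ : ℝ) : Compass → Plane → ℕ
  | E | W => homeRow s γ
  | N | S => homeCol s γ
  | NE | SW => antiDiag s γ
  | SE | NW => mainDiag s γ

/-- Columns gained by a step to the next home in direction `d`. -/
def eastStep : Compass → ℤ
  | E | NE | SE => 1
  | N | S => 0
  | W | NW | SW => -1

/-- Rows gained by a step to the next home in direction `d`. -/
def southStep : Compass → ℤ
  | S | SE | SW => 1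
  | E | W => 0
  | N | NE | NW => -1

/-- Position of the home of a node along its line, increasing towards the end `d`. -/
noncomputable def along (s γ : ℝ) (d : Compass) (p : Plane) : ℤ :=
  d.eastStep * homeCol s γ p + d.southStep * homeRow s γ p

/-- Component of `v` in direction `d`, times the length `1` or `√2` of a step. -/
noncomputable def forward (d : Compass) (v : Plane) : ℝ :=
  d.eastStep * east v + d.southStep * south v

/-- Component of `v` perpendicular to direction `d`, times the length `1` or `√2` of a step. -/
noncomputable def sideways (d : Compass) (v : Plane) : ℝ :=
  d.eastStep * south v - d.southStep * east v

variable {s γ : ℝ} {p q : Plane} (d : Compass)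

theorem exists_role_eq (r : Role) : ∃ (d : Compass) (i : ℕ), d.role i = r := by
  cases r with
  | E i => exact ⟨E, i, rfl⟩
  | W i => exact ⟨W, i, rfl⟩
  | N i => exact ⟨N, i, rfl⟩
  | S i => exact ⟨S, i, rfl⟩
  | NE i => exact ⟨NE, i, rfl⟩
  | SE i => exact ⟨SE, i, rfl⟩
  | NW i => exact ⟨NW, i, rfl⟩
  | SW i => exact ⟨SW, i, rfl⟩

theorem isSpokesman_role_iff (hγ : 0 < γ) {K : Set Plane} {i : ℕ} :
    IsSpokesman s γ K p (d.role i) ↔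
      p ∈ K ∧ d.line s γ p = i ∧ ∀ q ∈ K, d.line s γ q = i → d.along s γ q ≤ d.along s γ p := by
  have hp := homeRow_lt_homeRows s hγ p
  cases d <;>
    simp only [IsSpokesman, role, line, along, eastStep, southStep, antiDiag, mainDiag] <;>
    refine and_congr_right fun _ => and_congr_right fun hpi => forall₂_congr fun q _ =>
      forall_congr' fun hqi => ?_ <;>
    have hq := homeRow_lt_homeRows s hγ q <;> omega

theorem role_mem_turns (hγ : 0 < γ) (p : Plane) :
    d.role (d.line s γ p) ∈ turns (homeRows s γ) := by
  have hrow := homeRow_lt_homeRows s hγ p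
  have hcol := homeCol_lt_homeRows s hγ p
  cases d <;>
    simp only [role, line, antiDiag, mainDiag, turns, List.mem_append, List.mem_flatMap,
      List.mem_range, List.mem_cons, List.not_mem_nil, reduceCtorEq, Role.E.injEq, Role.W.injEq,
      Role.N.injEq, Role.S.injEq, Role.NE.injEq, Role.SE.injEq, Role.NW.injEq, Role.SW.injEq,
      exists_eq_right', or_false, false_or, and_false, exists_false] <;> omega

theorem home_eq_of_line_eq_of_along_eq (hγ : 0 < γ) (hline : d.line s γ p = d.line s γ q)
    (halong : d.along s γ p = d.along s γ q) :
    homeRow s γ p = homeRow s γ q ∧ homeCol s γ p = homeCol s γ q := by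
  have hp := homeRow_lt_homeRows s hγ p
  have hq := homeRow_lt_homeRows s hγ q
  cases d <;> simp only [line, antiDiag, mainDiag] at hline <;>
    simp only [along, eastStep, southStep] at halong <;> omega

theorem abs_sideways_sub_le_forward_sub (hγ : 0 < γ) (h : SameBlock s γ p q)
    (hd : γ ≤ dist p q) (hline : d.line s γ p = d.line s γ q)
    (halong : d.along s γ p ≤ d.along s γ q) :
    |d.sideways (q - p)| ≤ d.forward (q - p) := by
  have hE : homeCol s γ p < homeCol s γ q → east p < east q :=
    h.sameInterval_east.lt_of_homeIdx_lt hγ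
  have hW : homeCol s γ q < homeCol s γ p → east q < east p :=
    h.symm.sameInterval_east.lt_of_homeIdx_lt hγ
  have hS : homeRow s γ p < homeRow s γ q → south p < south q :=
    h.sameInterval_south.lt_of_homeIdx_lt hγ
  have hN : homeRow s γ q < homeRow s γ p → south q < south p :=
    h.symm.sameInterval_south.lt_of_homeIdx_lt hγ
  have hrow := h.abs_south_sub_lt_of_homeRow_eq hγ hd
  have hcol := h.abs_east_sub_lt_of_homeCol_eq hγ hd
  have hhome : ¬(homeRow s γ p = homeRow s γ q ∧ homeCol s γ p = homeCol s γ q) := fun hh =>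
    (h.dist_lt_of_home_eq hγ hh.1 hh.2).not_ge hd
  have hp := homeRow_lt_homeRows s hγ p
  have hq := homeRow_lt_homeRows s hγ q
  cases d <;> simp only [line, antiDiag, mainDiag] at hline <;>
    simp only [along, eastStep, southStep] at halong <;>
    simp only [forward, sideways, eastStep, southStep, east_sub, south_sub, abs_le] <;> grind

theorem exists_two_mul_abs_sideways_le_forward (t : Plane) :
    ∃ d : Compass, 2 * |d.sideways t| ≤ d.forward t := by
  by_contra! h
  have hE := h E
  have hW := h W
  have hN := h N
  have hS := h S
  have hNE := h NE
  have hSE := h SE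
  have hNW := h NW
  have hSW := h SW
  simp only [forward, sideways, eastStep, southStep, Int.cast_one, Int.cast_zero, Int.cast_neg]
    at hE hW hN hS hNE hSE hNW hSW
  grind

theorem norm_mul_norm_le_four_mul_inner {v t : Plane} (hv : |d.sideways v| ≤ d.forward v)
    (ht : 2 * |d.sideways t| ≤ d.forward t) : ‖v‖ * ‖t‖ ≤ 4 * ⟪v, t⟫_ℝ := by
  set N : ℝ := d.eastStep ^ 2 + d.southStep ^ 2 with hN
  have hN0 : 0 < N := by rw [hN]; cases d <;> norm_num [eastStep, southStep]
  have hnorm (w : Plane) : N * ‖w‖ ^ 2 = d.forward w ^ 2 + d.sideways w ^ 2 := by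
    rw [norm_sq_eq_east_sq_add_south_sq, forward, sideways]; ring
  have hinner : N * ⟪v, t⟫_ℝ = d.forward v * d.forward t + d.sideways v * d.sideways t := by
    rw [inner_eq_east_mul_add_south_mul, forward, forward, sideways, sideways]; ring
  have hv0 := (abs_nonneg _).trans hv
  have ht0 : 0 ≤ d.forward t := (by positivity : (0 : ℝ) ≤ 2 * |d.sideways t|).trans ht
  have hinner_ge : d.forward v * d.forward t ≤ 2 * (N * ⟪v, t⟫_ℝ) := by
    have hmul : |d.sideways v * d.sideways t| ≤ d.forward v * (d.forward t / 2) := by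
      rw [abs_mul]
      exact mul_le_mul hv (by linarith) (abs_nonneg _) hv0
    linarith [neg_abs_le (d.sideways v * d.sideways t)]
  have hv2 : N * ‖v‖ ^ 2 ≤ 2 * d.forward v ^ 2 := by
    linarith [hnorm v, sq_le_sq' (neg_le_of_abs_le hv) (le_of_abs_le hv)]
  have ht2 : N * ‖t‖ ^ 2 ≤ 2 * d.forward t ^ 2 := by
    have htle : |d.sideways t| ≤ d.forward t := by linarith [abs_nonneg (d.sideways t)]
    linarith [hnorm t, sq_le_sq' (neg_le_of_abs_le htle) (le_of_abs_le htle)]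
  have hnorm_le : N * (‖v‖ * ‖t‖) ≤ 2 * (d.forward v * d.forward t) := by
    refine le_of_sq_le_sq ?_ (by positivity)
    calc (N * (‖v‖ * ‖t‖)) ^ 2 = (N * ‖v‖ ^ 2) * (N * ‖t‖ ^ 2) := by ring
      _ ≤ (2 * d.forward v ^ 2) * (2 * d.forward t ^ 2) := by gcongr
      _ = (2 * (d.forward v * d.forward t)) ^ 2 := by ring
  exact le_of_mul_le_mul_left (by linarith) hN0

end Compass

theorem IsSpokesman.mem {s γ : ℝ} {K : Set Plane} {p : Plane} {r : Role}
    (h : IsSpokesman s γ K p r) : p ∈ K := by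
  cases r <;> exact h.1

/-- A set of nodes of one block, such as the possessors of the message in it: the sets of which
spokesmen are taken. -/
structure IsBlockSet (s γ : ℝ) (K : Set Plane) : Prop where
  sameBlock : ∀ p ∈ K, ∀ q ∈ K, SameBlock s γ p q
  separated : K.Pairwise fun p q => γ ≤ dist p q

namespace IsBlockSet

variable {s γ : ℝ} {K : Set Plane} {p q u v : Plane} {r : Role}

theorem eq_of_dist_lt (hK : IsBlockSet s γ K) (hp : p ∈ K) (hq : q ∈ K) (h : dist p q < γ) :
    p = q :=
  hK.separated.eq hp hq h.not_ge

theorem eq_or_dist_lt (hγ : 0 < γ) (hK : IsBlockSet s γ K) (hp : p ∈ K) (hq : q ∈ K) :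
    p = q ∨ dist p q < (1 - s) / 3 := by
  have hd := (hK.sameBlock p hp q hq).dist_lt hγ
  rw [sqrt_two_mul_blockLen] at hd
  exact (lt_max_iff.1 hd).symm.imp_left (hK.eq_of_dist_lt hp hq)

theorem eq_of_isSpokesman (hγ : 0 < γ) (hK : IsBlockSet s γ K) (hp : IsSpokesman s γ K p r)
    (hq : IsSpokesman s γ K q r) : p = q := by
  obtain ⟨d, i, rfl⟩ := Compass.exists_role_eq r
  obtain ⟨hpK, hpi, hpmax⟩ := (d.isSpokesman_role_iff hγ).1 hp
  obtain ⟨hqK, hqi, hqmax⟩ := (d.isSpokesman_role_iff hγ).1 hq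
  obtain ⟨hrow, hcol⟩ := d.home_eq_of_line_eq_of_along_eq hγ (hpi.trans hqi.symm)
    ((hqmax p hpK hpi).antisymm (hpmax q hqK hqi))
  exact hK.eq_of_dist_lt hpK hqK ((hK.sameBlock p hpK q hqK).dist_lt_of_home_eq hγ hrow hcol)

theorem exists_isSpokesman_towards (hγ : 0 < γ) (hK : IsBlockSet s γ K) (hfin : K.Finite)
    (hu : u ∈ K) (t : Plane) :
    ∃ w, ∃ r ∈ turns (homeRows s γ), IsSpokesman s γ K w r ∧
      ‖w - u‖ * ‖t‖ ≤ 4 * ⟪w - u, t⟫_ℝ := by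
  obtain ⟨d, hd⟩ := Compass.exists_two_mul_abs_sideways_le_forward t
  obtain ⟨w, ⟨hwK, hline⟩, hmax⟩ := Set.exists_max_image {q ∈ K | d.line s γ q = d.line s γ u}
    (d.along s γ) (hfin.subset fun q hq => hq.1) ⟨u, hu, rfl⟩
  refine ⟨w, _, d.role_mem_turns hγ u,
    (d.isSpokesman_role_iff hγ).2 ⟨hwK, hline, fun q hq hqi => hmax q ⟨hq, hqi⟩⟩, ?_⟩
  rcases eq_or_ne u w with rfl | hne
  · simp
  · exact d.norm_mul_norm_le_four_mul_inner
      (d.abs_sideways_sub_le_forward_sub hγ (hK.sameBlock u hu w hwK)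
        (hK.separated hu hwK hne) hline.symm (hmax u ⟨hu, rfl⟩)) hd

-- The spokesman is taken towards `v` if `v` is far from `u`, and away from `v` if `v` is near, so
-- that its distance to `v` respects one of the limits `s` and `1`. It respects the other one, as
-- the threshold `(2 + s) / 3` is at least `(1 - s) / 3` away from both limits.
theorem exists_isSpokesman_near (hs : 0 ≤ s) (hγ : 0 < γ) (hK : IsBlockSet s γ K)
    (hfin : K.Finite) (hu : u ∈ K) (hsuv : s < dist u v) (huv : dist u v ≤ 1) :
    ∃ w, ∃ r ∈ turns (homeRows s γ), IsSpokesman s γ K w r ∧ s < dist w v ∧ dist w v ≤ 1 := by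
  rcases le_or_gt ((2 + s) / 3) (dist u v) with hfar | hnear
  · obtain ⟨w, r, hr, hw, hinner⟩ := hK.exists_isSpokesman_towards hγ hfin hu (v - u)
    refine ⟨w, r, hr, hw, ?_⟩
    rcases hK.eq_or_dist_lt hγ hw.mem hu with rfl | hwu
    · exact ⟨hsuv, huv⟩
    have hle : dist w v ≤ dist u v := by
      rw [dist_comm u v, dist_comm w v, dist_eq_norm, dist_eq_norm,
        ← sub_sub_sub_cancel_right v w u]
      refine norm_sub_le_of_norm_sq_le_two_mul_inner ?_
      have hshort : 2 * ‖w - u‖ ≤ ‖v - u‖ := by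
        rw [← dist_eq_norm, ← dist_eq_norm, dist_comm v u]; linarith
      linarith [mul_le_mul_of_nonneg_left hshort (norm_nonneg (w - u)), sq ‖w - u‖]
    exact ⟨by linarith [dist_triangle_left u v w], hle.trans huv⟩
  · obtain ⟨w, r, hr, hw, hinner⟩ := hK.exists_isSpokesman_towards hγ hfin hu (u - v)
    refine ⟨w, r, hr, hw, ?_⟩
    rcases hK.eq_or_dist_lt hγ hw.mem hu with rfl | hwu
    · exact ⟨hsuv, huv⟩
    have hge : dist u v ≤ dist w v := by
      rw [dist_eq_norm, dist_eq_norm, ← sub_add_sub_cancel w u v]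
      exact norm_le_norm_add_of_inner_nonneg (by
        linarith [mul_nonneg (norm_nonneg (w - u)) (norm_nonneg (u - v))])
    exact ⟨hsuv.trans_le hge, by linarith [dist_triangle w u v]⟩

end IsBlockSet

/-! ## Rounds -/

section Reception

variable {P : Type*} {s : ℝ} {V : Finset Plane} {tx : V → Option P} {u v : V} {p q : P}

theorem Receives.unique (hp : Receives s tx v p) (hq : Receives s tx v q) : p = q := by
  obtain ⟨-, -, u, hadj, hu, -⟩ := hp
  obtain ⟨-, -, w, -, hw, hwuniq⟩ := hq
  obtain rfl := hwuniq u hadj (by simp [hu])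
  exact Option.some_inj.1 (hu.symm.trans hw)

theorem heard_eq_some_iff : heard s tx v = some p ↔ Receives s tx v p := by
  unfold heard
  split_ifs with h
  · rw [Option.some_inj]
    exact ⟨fun e => e ▸ h.choose_spec, fun e => h.choose_spec.unique e⟩
  · simpa using fun hp => h ⟨p, hp⟩

theorem exists_eq_some_of_heard_eq_some (h : heard s tx v = some p) : ∃ u, tx u = some p :=
  let ⟨_, _, u, _, hu, _⟩ := heard_eq_some_iff.1 h
  ⟨u, hu⟩

theorem heard_eq_some_of_isolated (hadj : (network s V).Adj u v) (hu : tx u = some p)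
    (hiso : ∀ w : V, tx w ≠ none → dist (w : Plane) u ≤ 2 → w = u) : heard s tx v = some p := by
  have huniq (w : V) (hw : tx w ≠ none) (hwv : dist (w : Plane) v ≤ 1) : w = u :=
    hiso w hw (by linarith [dist_triangle_right (w : Plane) u v, hadj.2.2])
  refine heard_eq_some_iff.2 ⟨?_, fun w hwv => ?_, u, hadj, hu, fun w hwv hw => huniq w hw hwv.2.2⟩
  · by_contra hv
    exact hadj.1 (huniq v hv (by simp)).symm
  · by_contra hw
    obtain rfl := huniq w hw (by linarith [hadj.2.1, hadj.2.2])
    exact hadj.2.1.not_ge hwv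

end Reception

section Tasks

variable {M : Type*} {s γ : ℝ} {p : Plane} {a : NodeState M} {h : Option (Packet M)} {k : Task}

@[simp] theorem updateTask_msg (info : Set Plane) : (updateTask info a k).msg = a.msg := by
  unfold updateTask; split <;> rfl

@[simp] theorem updateTask_sent (info : Set Plane) : (updateTask info a k).sent = a.sent := by
  unfold updateTask; split <;> rfl

theorem msg_eq_some_of_sendTask_eq {m : M} (hm : sendTask s γ p a k = some (.message m)) :
    a.msg = some m := by
  cases k with
  | hello x => simp [sendTask] at hm
  | probe y x => simp [sendTask] at hm
  | relay b r =>
    obtain ⟨m', hm', heq⟩ := Option.map_eq_some_iff.1 (Option.ite_none_right_eq_some.1 hm).2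
    exact Packet.message.inj heq ▸ hm'

theorem sendTask_relay_ne_none_iff {b r : ℕ} : sendTask s γ p a (.relay b r) ≠ none ↔
    blockLabel s γ p = b ∧ a.sent = false ∧
      (∃ role, (turns (homeRows s γ))[r]? = some role ∧ IsSpokesman s γ a.holders p role) ∧
      a.msg ≠ none := by
  simp only [sendTask]
  split_ifs <;> simp [*]; grind

theorem sendTask_relay_eq_of_ne_none {b r : ℕ} (hne : sendTask s γ p a (.relay b r) ≠ none) :
    sendTask s γ p a (.relay b r) = a.msg.map .message := by
  have hturn := sendTask_relay_ne_none_iff.1 hne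
  exact if_pos ⟨hturn.1, hturn.2.1, hturn.2.2.1⟩

@[simp] theorem listenTask_holders : (listenTask s γ p a h k).holders = a.holders := by
  cases k <;> simp only [listenTask] <;> (try split_ifs) <;> rfl

theorem listenTask_relay_msg {m : M} {b r : ℕ} :
    (listenTask s γ p a (some (.message m)) (.relay b r)).msg = some m := rfl

theorem listenTask_msg : (listenTask s γ p a h k).msg = a.msg ∨
    ∃ m, h = some (.message m) ∧ (listenTask s γ p a h k).msg = some m := by
  cases k with
  | hello x => left; simp only [listenTask]; split_ifs <;> rfl
  | probe y x => left; simp only [listenTask]; split_ifs <;> rfl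
  | relay b r =>
    rcases h with _ | (_ | m)
    · exact .inl rfl
    · exact .inl rfl
    · exact .inr ⟨m, rfl, rfl⟩

theorem listenTask_sent : (listenTask s γ p a h k).sent = true ↔
    a.sent = true ∨ (∃ b r, k = .relay b r) ∧ sendTask s γ p a k ≠ none := by
  cases k with
  | hello x => simp only [listenTask]; split_ifs <;> simp
  | probe y x => simp only [listenTask]; split_ifs <;> simp
  | relay b r => simp [listenTask, Option.isSome_iff_ne_none]

end Tasks

/-! ## Executions -/

section Execution

variable {M : Type*} (s γ : ℝ) {V : Finset Plane} (src : V) (m : M)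

/-- The states in round `t` after the local computation at its beginning. -/
noncomputable def updatedB2 (t : ℕ) : V → NodeState M :=
  updated (algorithmB2 M s γ) (blockHolders s γ) t (statesB2 s γ src m t)

/-- The packets transmitted in round `t`. -/
noncomputable def packetsB2 (t : ℕ) : V → Option (Packet M) :=
  transmissions (algorithmB2 M s γ) (blockHolders s γ) t (statesB2 s γ src m t)

/-- `u` possesses the source message after `t` rounds. -/
def Informed (t : ℕ) (u : V) : Prop := (statesB2 s γ src m t u).msg = some m

/-- `u` has sent the source message in the first `t` rounds. -/
def HasSent (t : ℕ) (u : V) : Prop := (statesB2 s γ src m t u).sent = true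

variable {s γ src m} {t t' : ℕ} {u v w : V}

theorem updatedB2_apply : updatedB2 s γ src m t u =
    updateTask (blockHolders s γ (statesB2 s γ src m t) u) (statesB2 s γ src m t u)
      (task s γ t) := rfl

theorem packetsB2_apply :
    packetsB2 s γ src m t u = sendTask s γ u (updatedB2 s γ src m t u) (task s γ t) := rfl

theorem statesB2_succ : statesB2 s γ src m (t + 1) u =
    listenTask s γ u (updatedB2 s γ src m t u) (heard s (packetsB2 s γ src m t) u)
      (task s γ t) := rfl

@[simp] theorem updatedB2_msg :
    (updatedB2 s γ src m t u).msg = (statesB2 s γ src m t u).msg := updateTask_msg _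

@[simp] theorem updatedB2_sent :
    (updatedB2 s γ src m t u).sent = (statesB2 s γ src m t u).sent := updateTask_sent _

theorem transmitsB2_iff : TransmitsB2 s γ src m t u ↔ packetsB2 s γ src m t u ≠ none := Iff.rfl

theorem informed_zero : Informed s γ src m 0 src := by
  simp [Informed, statesB2, states, algorithmB2]

theorem not_hasSent_zero : ¬HasSent s γ src m 0 u := by
  simp [HasSent, statesB2, states, algorithmB2]

variable (s γ src m) in
theorem statesB2_succ_msg (t : ℕ) (u : V) :
    (statesB2 s γ src m (t + 1) u).msg = (statesB2 s γ src m t u).msg ∨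
      ∃ m', heard s (packetsB2 s γ src m t) u = some (.message m') ∧
        (statesB2 s γ src m (t + 1) u).msg = some m' := by
  rw [statesB2_succ, ← updatedB2_msg]
  exact listenTask_msg

theorem eq_of_statesB2_msg_eq_some {m' : M} (h : (statesB2 s γ src m t u).msg = some m') :
    m' = m := by
  induction t generalizing u m' with
  | zero =>
    simp only [statesB2, states, algorithmB2, Option.ite_none_right_eq_some, Option.some_inj] at h
    exact h.2.symm
  | succ t ih =>
    rcases statesB2_succ_msg s γ src m t u with hkeep | ⟨m'', hheard, hnew⟩
    · exact ih (hkeep.symm.trans h)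
    · obtain rfl := Option.some_inj.1 (hnew.symm.trans h)
      obtain ⟨w, hw⟩ := exists_eq_some_of_heard_eq_some hheard
      rw [packetsB2_apply] at hw
      exact ih (updatedB2_msg.symm.trans (msg_eq_some_of_sendTask_eq hw))

theorem informed_iff : Informed s γ src m t u ↔ (statesB2 s γ src m t u).msg ≠ none := by
  refine ⟨fun h => by rw [show _ = _ from h]; simp, fun h => ?_⟩
  obtain ⟨m', hm'⟩ := Option.ne_none_iff_exists'.1 h
  exact hm'.trans (congrArg some (eq_of_statesB2_msg_eq_some hm'))

theorem Informed.mono (ht : t ≤ t') (h : Informed s γ src m t u) : Informed s γ src m t' u := by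
  induction t', ht using Nat.le_induction with
  | base => exact h
  | succ t' _ ih =>
    rw [informed_iff] at ih ⊢
    rcases statesB2_succ_msg s γ src m t' u with hkeep | ⟨m', -, hnew⟩
    · rwa [hkeep]
    · simp [hnew]

theorem hasSent_succ_iff : HasSent s γ src m (t + 1) u ↔ HasSent s γ src m t u ∨
    (∃ b r, task s γ t = .relay b r) ∧ TransmitsB2 s γ src m t u := by
  rw [HasSent, statesB2_succ, listenTask_sent, updatedB2_sent, ← packetsB2_apply]
  rfl

theorem HasSent.mono (ht : t ≤ t') (h : HasSent s γ src m t u) : HasSent s γ src m t' u := by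
  induction t', ht using Nat.le_induction with
  | base => exact h
  | succ t' _ ih => exact hasSent_succ_iff.2 (.inl ih)

theorem informed_of_forall_not_transmitsB2 {i : ℕ}
    (hsilent : ∀ j < i, ∀ u, ¬TransmitsB2 s γ src m (t + j) u)
    (h : Informed s γ src m (t + i) u) : Informed s γ src m t u := by
  induction i with
  | zero => exact h
  | succ i ih =>
    refine ih (fun j hj => hsilent j (by omega)) ?_
    rcases statesB2_succ_msg s γ src m (t + i) u with hkeep | ⟨m', hheard, -⟩
    · exact hkeep.symm.trans h
    · obtain ⟨w, hw⟩ := exists_eq_some_of_heard_eq_some hheard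
      exact absurd (transmitsB2_iff.2 (by simp [hw])) (hsilent i (by omega) w)

end Execution

/-! ## Phases and iterations -/

section Phase

theorem length_turns (k : ℕ) : (turns k).length = 4 * k + 4 * (2 * k - 1) := by
  simp [turns, List.length_flatMap]
  omega

/-- First round of the `n`-th phase, where the phases are counted through all iterations. -/
noncomputable def phaseStart (s γ : ℝ) (n : ℕ) : ℕ := discoveryTime s γ + n * numTurns s γ

/-- First round of the `j`-th iteration. -/
noncomputable def iterationStart (s γ : ℝ) (j : ℕ) : ℕ :=
  discoveryTime s γ + j * iterationTime s γ

variable {s γ : ℝ} {t n r : ℕ}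

theorem numTurns_pos (s : ℝ) (hγ : 0 < γ) : 0 < numTurns s γ := by
  have := homeRows_pos s hγ
  rw [numTurns, length_turns]
  omega

theorem phaseStart_succ (s γ : ℝ) (n : ℕ) :
    phaseStart s γ (n + 1) = phaseStart s γ n + numTurns s γ := by
  unfold phaseStart; ring

theorem phaseStart_mono (s γ : ℝ) : Monotone (phaseStart s γ) :=
  monotone_nat_of_le_succ fun n => (phaseStart_succ s γ n).symm ▸ Nat.le_add_right _ _

theorem iterationStart_eq_phaseStart (s γ : ℝ) (j : ℕ) :
    iterationStart s γ j = phaseStart s γ (j * numBlocks s γ) := by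
  unfold iterationStart phaseStart iterationTime; ring

theorem iterationStart_mono (s γ : ℝ) : Monotone (iterationStart s γ) := fun _ _ h =>
  Nat.add_le_add_left (Nat.mul_le_mul_right _ h) _

theorem exists_eq_phaseStart_add (hγ : 0 < γ) (ht : phaseStart s γ n ≤ t) :
    ∃ k ≥ n, ∃ r < numTurns s γ, t = phaseStart s γ k + r := by
  refine ⟨n + (t - phaseStart s γ n) / numTurns s γ, Nat.le_add_right _ _,
    (t - phaseStart s γ n) % numTurns s γ, Nat.mod_lt _ (numTurns_pos s hγ), ?_⟩
  have := Nat.div_add_mod' (t - phaseStart s γ n) (numTurns s γ)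
  unfold phaseStart at *
  rw [add_mul]
  omega

theorem task_phaseStart_add (n : ℕ) (hr : r < numTurns s γ) :
    task s γ (phaseStart s γ n + r) = .relay (n % numBlocks s γ) r := by
  have hlabels : numLabels s γ ≤ discoveryTime s γ := Nat.le_add_right _ _
  have hstart : discoveryTime s γ ≤ phaseStart s γ n := Nat.le_add_right _ _
  have hsub : phaseStart s γ n + r - discoveryTime s γ = r + numTurns s γ * n := by
    rw [phaseStart, add_assoc, Nat.add_sub_cancel_left]; ring
  rw [task, if_neg (by omega), if_neg (by omega), hsub,
    Nat.add_mul_div_left _ _ (Nat.zero_lt_of_lt hr), Nat.div_eq_of_lt hr, zero_add,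
    Nat.add_mul_mod_self_left, Nat.mod_eq_of_lt hr]

theorem exists_eq_phaseStart_add_of_task_eq_relay (hγ : 0 < γ) {b : ℕ}
    (h : task s γ t = .relay b r) : ∃ n, ∃ i < numTurns s γ, t = phaseStart s γ n + i := by
  have ht : phaseStart s γ 0 ≤ t := by
    unfold task at h
    unfold phaseStart
    split_ifs at h
    omega
  obtain ⟨n, -, hn⟩ := exists_eq_phaseStart_add hγ ht
  exact ⟨n, hn⟩

end Phase

section Holders

variable {M : Type*} {s γ : ℝ} {V : Finset Plane} {u w : V}

theorem blockHolders_congr (st : V → NodeState M) (h : SameBlock s γ u w) :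
    blockHolders s γ st u = blockHolders s γ st w := by
  ext p
  exact ⟨fun ⟨x, hx, hxu, hmsg⟩ => ⟨x, hx, hxu.trans h, hmsg⟩,
    fun ⟨x, hx, hxw, hmsg⟩ => ⟨x, hx, hxw.trans h.symm, hmsg⟩⟩

theorem blockHolders_subset (st : V → NodeState M) : blockHolders s γ st u ⊆ V := by
  rintro _ ⟨x, rfl, -⟩
  exact x.2

theorem isBlockSet_blockHolders (hV : (V : Set Plane).Pairwise fun p q => γ ≤ dist p q)
    (st : V → NodeState M) (u : V) : IsBlockSet s γ (blockHolders s γ st u) where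
  sameBlock := by
    rintro _ ⟨x, rfl, hx, -⟩ _ ⟨y, rfl, hy, -⟩
    exact hx.trans hy.symm
  separated := hV.mono (blockHolders_subset st)

end Holders

section Transmission

variable {M : Type*} (s γ : ℝ) {V : Finset Plane} (src : V) (m : M)

/-- The possessors of the message in the block of `u` at the beginning of the `n`-th phase: if
this is a phase of that block, its spokesmen are taken of this set. -/
def phaseHolders (n : ℕ) (u : V) : Set Plane :=
  blockHolders s γ (statesB2 s γ src m (phaseStart s γ n)) u

variable {s γ src m} {n r t : ℕ} {u v w : V} {role : Role}

theorem updatedB2_holders_phaseStart_add (hr : r < numTurns s γ) :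
    (updatedB2 s γ src m (phaseStart s γ n + r) u).holders = phaseHolders s γ src m n u := by
  induction r with
  | zero =>
    rw [updatedB2_apply, task_phaseStart_add n hr]
    rfl
  | succ r ih =>
    rw [updatedB2_apply, task_phaseStart_add n hr, ← ih (by omega), ← add_assoc, statesB2_succ]
    exact listenTask_holders

theorem informed_of_mem_phaseHolders (h : ↑u ∈ phaseHolders s γ src m n w) :
    Informed s γ src m (phaseStart s γ n) u := by
  obtain ⟨x, hx, -, hmsg⟩ := h
  obtain rfl := Subtype.ext hx
  exact informed_iff.2 hmsg

theorem transmitsB2_phaseStart_add_iff (hr : r < numTurns s γ) :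
    TransmitsB2 s γ src m (phaseStart s γ n + r) u ↔
      blockLabel s γ u = n % numBlocks s γ ∧ ¬HasSent s γ src m (phaseStart s γ n + r) u ∧
        ∃ role, (turns (homeRows s γ))[r]? = some role ∧
          IsSpokesman s γ (phaseHolders s γ src m n u) u role := by
  rw [transmitsB2_iff, packetsB2_apply, task_phaseStart_add n hr, sendTask_relay_ne_none_iff,
    updatedB2_holders_phaseStart_add hr, updatedB2_msg, updatedB2_sent, ← informed_iff, HasSent,
    Bool.not_eq_true]
  refine and_congr_right fun _ => and_congr_right fun _ => and_iff_left_of_imp ?_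
  rintro ⟨role, -, hrole⟩
  exact (informed_of_mem_phaseHolders hrole.mem).mono (Nat.le_add_right _ _)

theorem packetsB2_eq_message (hr : r < numTurns s γ)
    (hu : TransmitsB2 s γ src m (phaseStart s γ n + r) u) :
    packetsB2 s γ src m (phaseStart s γ n + r) u = some (.message m) := by
  obtain ⟨-, -, role, -, hrole⟩ := (transmitsB2_phaseStart_add_iff hr).1 hu
  have hinf := (informed_of_mem_phaseHolders hrole.mem).mono (Nat.le_add_right _ r)
  rw [transmitsB2_iff, packetsB2_apply, task_phaseStart_add n hr] at hu
  rw [packetsB2_apply, task_phaseStart_add n hr, sendTask_relay_eq_of_ne_none hu, updatedB2_msg,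
    hinf, Option.map_some]

theorem eq_of_transmitsB2 (hs : 0 ≤ s) (hγ : 0 < γ) (hγ1 : γ ≤ 1)
    (hV : (V : Set Plane).Pairwise fun p q => γ ≤ dist p q) (hr : r < numTurns s γ)
    (hu : TransmitsB2 s γ src m (phaseStart s γ n + r) u)
    (hw : TransmitsB2 s γ src m (phaseStart s γ n + r) w) (hd : dist (u : Plane) w ≤ 2) :
    u = w := by
  obtain ⟨hub, -, role, hrole, hur⟩ := (transmitsB2_phaseStart_add_iff hr).1 hu
  obtain ⟨hwb, -, role', hrole', hwr⟩ := (transmitsB2_phaseStart_add_iff hr).1 hw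
  obtain rfl := Option.some_inj.1 (hrole.symm.trans hrole')
  have hsame := sameBlock_of_dist_le_two hs hγ hγ1 (hub.trans hwb.symm) hd
  rw [phaseHolders, ← blockHolders_congr _ hsame] at hwr
  exact Subtype.ext ((isBlockSet_blockHolders hV _ u).eq_of_isSpokesman hγ hur hwr)

theorem informed_of_transmitsB2 (hs : 0 ≤ s) (hγ : 0 < γ) (hγ1 : γ ≤ 1)
    (hV : (V : Set Plane).Pairwise fun p q => γ ≤ dist p q) (hr : r < numTurns s γ)
    (hu : TransmitsB2 s γ src m (phaseStart s γ n + r) u) (hadj : (network s V).Adj u v) :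
    Informed s γ src m (phaseStart s γ n + r + 1) v := by
  rw [Informed, statesB2_succ, heard_eq_some_of_isolated hadj (packetsB2_eq_message hr hu)
    fun w hw hd => eq_of_transmitsB2 hs hγ hγ1 hV hr (transmitsB2_iff.2 hw) hu hd,
    task_phaseStart_add n hr, listenTask_relay_msg]

theorem HasSent.informed (hs : 0 ≤ s) (hγ : 0 < γ) (hγ1 : γ ≤ 1)
    (hV : (V : Set Plane).Pairwise fun p q => γ ≤ dist p q) (hu : HasSent s γ src m t u)
    (hadj : (network s V).Adj u v) : Informed s γ src m t v := by
  induction t with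
  | zero => exact absurd hu not_hasSent_zero
  | succ t ih =>
    rcases hasSent_succ_iff.1 hu with hu | ⟨⟨b, i, htask⟩, hu⟩
    · exact (ih hu).mono (Nat.le_succ t)
    · obtain ⟨n, r, hr, rfl⟩ := exists_eq_phaseStart_add_of_task_eq_relay hγ htask
      exact informed_of_transmitsB2 hs hγ hγ1 hV hr hu hadj

theorem hasSent_of_isSpokesman (hlabel : blockLabel s γ u = n % numBlocks s γ)
    (hrole : role ∈ turns (homeRows s γ))
    (hu : IsSpokesman s γ (phaseHolders s γ src m n u) u role) :
    HasSent s γ src m (phaseStart s γ (n + 1)) u := by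
  obtain ⟨r, hr, hget⟩ := List.getElem_of_mem hrole
  have hturn : phaseStart s γ n + r + 1 ≤ phaseStart s γ (n + 1) := by
    rw [phaseStart_succ, numTurns]; omega
  refine HasSent.mono hturn (hasSent_succ_iff.2 (or_iff_not_imp_left.2 fun hsent => ?_))
  exact ⟨⟨_, _, task_phaseStart_add n hr⟩, (transmitsB2_phaseStart_add_iff hr).2
    ⟨hlabel, hsent, role, (List.getElem?_eq_getElem hr).trans (congrArg some hget), hu⟩⟩

theorem informed_phaseStart_succ_of_adj (hs : 0 ≤ s) (hγ : 0 < γ) (hγ1 : γ ≤ 1)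
    (hV : (V : Set Plane).Pairwise fun p q => γ ≤ dist p q)
    (hlabel : blockLabel s γ u = n % numBlocks s γ)
    (hu : Informed s γ src m (phaseStart s γ n) u) (hadj : (network s V).Adj u v) :
    Informed s γ src m (phaseStart s γ (n + 1)) v := by
  obtain ⟨w, role, hrole, hw, hswv, hwv⟩ :=
    (isBlockSet_blockHolders hV (statesB2 s γ src m (phaseStart s γ n)) u).exists_isSpokesman_near
      hs hγ (V.finite_toSet.subset (blockHolders_subset _))
      ⟨u, rfl, .refl _ _ _, informed_iff.1 hu⟩ hadj.2.1 hadj.2.2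
  obtain ⟨w, rfl, hwu, -⟩ := hw.mem
  have hwadj : (network s V).Adj w v := by
    refine ⟨?_, hswv, hwv⟩
    rintro rfl
    exact (hs.trans_lt hswv).ne' (dist_self _)
  rw [← blockHolders_congr _ hwu] at hw
  exact (hasSent_of_isSpokesman (hwu.blockLabel_eq.trans hlabel) hrole hw).informed hs hγ hγ1 hV
    hwadj

theorem informed_iterationStart_succ_of_adj (hs : 0 ≤ s) (hγ : 0 < γ) (hγ1 : γ ≤ 1)
    (hV : (V : Set Plane).Pairwise fun p q => γ ≤ dist p q) (j : ℕ)
    (hu : Informed s γ src m (iterationStart s γ j) u) (hadj : (network s V).Adj u v) :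
    Informed s γ src m (iterationStart s γ (j + 1)) v := by
  have hlabel := blockLabel_lt_numBlocks s hγ u
  rw [iterationStart_eq_phaseStart] at hu ⊢
  refine (informed_phaseStart_succ_of_adj (n := j * numBlocks s γ + blockLabel s γ u) hs hγ hγ1 hV
    (by rw [Nat.mul_add_mod_self_right, Nat.mod_eq_of_lt hlabel])
    (hu.mono (phaseStart_mono s γ (Nat.le_add_right _ _))) hadj).mono (phaseStart_mono s γ ?_)
  rw [add_one_mul]
  omega

end Transmission

section Walk

variable {V : Type*} {G : SimpleGraph V} {P : ℕ → V → Prop}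

theorem walk_propagate (hP : ∀ j u v, G.Adj u v → P j u → P (j + 1) v) {u v : V}
    (p : G.Walk u v) {j : ℕ} (h : P j u) : P (j + p.length) v := by
  induction p generalizing j with
  | nil => exact h
  | cons hadj p ih =>
    rw [SimpleGraph.Walk.length_cons, add_comm p.length, ← add_assoc]
    exact ih (hP _ _ _ hadj h)

end Walk

section Termination

variable {M : Type*} {s γ : ℝ} {V : Finset Plane} {src : V} {m : M} {t j : ℕ} {u : V}

theorem phaseHolders_eq_of_forall_informed {n k : ℕ} (hnk : n ≤ k)
    (hall : ∀ v, Informed s γ src m (phaseStart s γ n) v) :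
    phaseHolders s γ src m k u = phaseHolders s γ src m n u := by
  ext p
  simp only [phaseHolders, blockHolders, Set.mem_ofPred_eq, ← informed_iff, hall,
    fun v => (hall v).mono (phaseStart_mono s γ hnk)]

theorem not_transmitsB2_of_forall_informed (hγ : 0 < γ)
    (hall : ∀ v, Informed s γ src m (iterationStart s γ j) v)
    (ht : iterationStart s γ (j + 1) ≤ t) (u : V) : ¬TransmitsB2 s γ src m t u := by
  intro hu
  rw [iterationStart_eq_phaseStart] at ht
  simp only [iterationStart_eq_phaseStart] at hall
  obtain ⟨n, hn, r, hr, rfl⟩ := exists_eq_phaseStart_add hγ ht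
  obtain ⟨-, hsent, role, hrole, hspoke⟩ := (transmitsB2_phaseStart_add_iff hr).1 hu
  have hlabel := blockLabel_lt_numBlocks s hγ u
  rw [add_one_mul] at hn
  rw [phaseHolders_eq_of_forall_informed (by omega) hall, ← phaseHolders_eq_of_forall_informed
    (Nat.le_add_right _ (blockLabel s γ u)) hall] at hspoke
  refine hsent ((hasSent_of_isSpokesman ?_ (List.mem_of_getElem? hrole) hspoke).mono
    ((phaseStart_mono s γ (by omega)).trans (Nat.le_add_right _ r)))
  rw [Nat.mul_add_mod_self_right, Nat.mod_eq_of_lt hlabel]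

theorem informed_of_silentIteration (hs : 0 ≤ s) (hγ : 0 < γ) (hγ1 : γ ≤ 1)
    (hV : (V : Set Plane).Pairwise fun p q => γ ≤ dist p q) (hconn : (network s V).Connected)
    (hj : SilentIteration s γ src m j) (v : V) :
    Informed s γ src m (iterationStart s γ j) v := by
  obtain ⟨p⟩ := hconn src v
  refine walk_propagate (P := fun _ v => Informed s γ src m (iterationStart s γ j) v)
    (fun _ x y hxy hx => informed_of_forall_not_transmitsB2 hj ?_) p (j := 0)
    (informed_zero.mono (Nat.zero_le _))
  have hstart : iterationStart s γ (j + 1) = iterationStart s γ j + iterationTime s γ := by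
    unfold iterationStart; ring
  exact hstart ▸ informed_iterationStart_succ_of_adj hs hγ hγ1 hV j hx hxy

theorem informed_iterationStart_diam (hs : 0 ≤ s) (hγ : 0 < γ) (hγ1 : γ ≤ 1)
    (hV : (V : Set Plane).Pairwise fun p q => γ ≤ dist p q) (hconn : (network s V).Connected)
    (v : V) : Informed s γ src m (iterationStart s γ (network s V).diam) v := by
  have : Nonempty V := ⟨src⟩
  obtain ⟨p, hp⟩ := hconn.exists_walk_length_eq_dist src v
  refine (walk_propagate
    (fun j x y hxy hx => informed_iterationStart_succ_of_adj hs hγ hγ1 hV j hx hxy) p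
    (informed_zero.mono (Nat.zero_le (iterationStart s γ 0)))).mono (iterationStart_mono s γ ?_)
  rw [zero_add, hp]
  exact SimpleGraph.dist_le_diam (SimpleGraph.connected_iff_ediam_ne_top.1 hconn)

variable (src m) in
theorem exists_endsAt (hs : 0 ≤ s) (hγ : 0 < γ) (hγ1 : γ ≤ 1)
    (hV : (V : Set Plane).Pairwise fun p q => γ ≤ dist p q) (hconn : (network s V).Connected) :
    ∃ T, EndsAt s γ src m T ∧ (∀ u, Informed s γ src m T u) ∧
      T ≤ discoveryTime s γ + ((network s V).diam + 2) * iterationTime s γ := by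
  classical
  have hsilent : SilentIteration s γ src m ((network s V).diam + 1) := fun i _ u =>
    not_transmitsB2_of_forall_informed hγ
      (informed_iterationStart_diam hs hγ hγ1 hV hconn) (Nat.le_add_right _ i) u
  have hex : ∃ j, SilentIteration s γ src m j := ⟨_, hsilent⟩
  refine ⟨iterationStart s γ (Nat.find hex + 1),
    ⟨_, Nat.find_spec hex, fun i hi => Nat.find_min hex hi, rfl⟩, fun u => ?_, ?_⟩
  · exact (informed_of_silentIteration hs hγ hγ1 hV hconn (Nat.find_spec hex) u).mono
      (iterationStart_mono s γ (Nat.le_succ _))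
  · exact iterationStart_mono s γ (Nat.succ_le_succ (Nat.find_min' hex hsilent))

end Termination

/-! ## Running time -/

section RunningTime

variable {s γ : ℝ}

theorem le_sqrt_two_mul_blockLen (s γ : ℝ) : γ ≤ √2 * blockLen s γ :=
  (le_max_right _ _).trans_eq (sqrt_two_mul_blockLen s γ).symm

theorem one_div_blockLen_le (s : ℝ) (hγ : 0 < γ) : 1 / blockLen s γ ≤ 2 * (1 / γ) := by
  have hl := blockLen_pos s hγ
  have h := le_sqrt_two_mul_blockLen s γ
  have hγl : γ ≤ 2 * blockLen s γ :=
    h.trans (by gcongr; linarith [Real.sqrt_two_lt_three_halves])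
  rw [mul_one_div, div_le_div_iff₀ hl hγ]
  linarith

theorem blockRows_le (hs : 0 ≤ s) (hγ : 0 < γ) (hγ1 : γ ≤ 1) :
    (blockRows s γ : ℝ) ≤ 4 / blockLen s γ := by
  have hl := blockLen_pos s hγ
  calc (blockRows s γ : ℝ) ≤ 3 / blockLen s γ + 1 := (Nat.ceil_lt_add_one (by positivity)).le
    _ ≤ 3 / blockLen s γ + 1 / blockLen s γ := by
        gcongr; exact (one_le_div hl).2 (blockLen_lt_one hs hγ1).le
    _ = 4 / blockLen s γ := by ring

theorem homeRows_le (s : ℝ) (hγ : 0 < γ) : (homeRows s γ : ℝ) ≤ 3 * (blockLen s γ / γ) := by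
  have hl := blockLen_pos s hγ
  calc (homeRows s γ : ℝ) ≤ √2 * blockLen s γ / γ + 1 := (Nat.ceil_lt_add_one (by positivity)).le
    _ ≤ √2 * blockLen s γ / γ + √2 * blockLen s γ / γ := by
        gcongr; exact (one_le_div hγ).2 (le_sqrt_two_mul_blockLen s γ)
    _ = 2 * √2 * (blockLen s γ / γ) := by ring
    _ ≤ 3 * (blockLen s γ / γ) := by gcongr; linarith [Real.sqrt_two_lt_three_halves]

theorem numBlocks_le (hs : 0 ≤ s) (hγ : 0 < γ) (hγ1 : γ ≤ 1) :
    (numBlocks s γ : ℝ) ≤ 16 / blockLen s γ ^ 2 := by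
  calc (numBlocks s γ : ℝ) = blockRows s γ ^ 2 := by rw [numBlocks, Nat.cast_pow]
    _ ≤ (4 / blockLen s γ) ^ 2 := by gcongr; exact blockRows_le hs hγ hγ1
    _ = 16 / blockLen s γ ^ 2 := by ring

theorem numLabels_le (hs : 0 ≤ s) (hγ : 0 < γ) (hγ1 : γ ≤ 1) :
    (numLabels s γ : ℝ) ≤ 144 * (1 / γ) ^ 2 := by
  have hl := blockLen_pos s hγ
  calc (numLabels s γ : ℝ) = numBlocks s γ * homeRows s γ ^ 2 := by
        rw [numLabels, numHomes, Nat.cast_mul, Nat.cast_pow]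
    _ ≤ 16 / blockLen s γ ^ 2 * (3 * (blockLen s γ / γ)) ^ 2 := by
        gcongr
        exacts [numBlocks_le hs hγ hγ1, homeRows_le s hγ]
    _ = 144 * (1 / γ) ^ 2 := by field_simp; norm_num

theorem numTurns_le (s : ℝ) (hγ : 0 < γ) : (numTurns s γ : ℝ) ≤ 36 * (blockLen s γ / γ) := by
  have h : numTurns s γ ≤ 12 * homeRows s γ := by rw [numTurns, length_turns]; omega
  calc (numTurns s γ : ℝ) ≤ 12 * homeRows s γ := by exact_mod_cast h
    _ ≤ 12 * (3 * (blockLen s γ / γ)) := by gcongr; exact homeRows_le s hγ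
    _ = 36 * (blockLen s γ / γ) := by ring

theorem discoveryTime_le (hs : 0 ≤ s) (hγ : 0 < γ) (hγ1 : γ ≤ 1) :
    (discoveryTime s γ : ℝ) ≤ 20880 * (1 / γ) ^ 4 := by
  have hg : 1 ≤ 1 / γ := (one_le_div hγ).2 hγ1
  have hn := numLabels_le hs hγ hγ1
  calc (discoveryTime s γ : ℝ) = numLabels s γ + numLabels s γ * numLabels s γ := by
        rw [discoveryTime, Nat.cast_add, Nat.cast_mul]
    _ ≤ 144 * (1 / γ) ^ 2 + 144 * (1 / γ) ^ 2 * (144 * (1 / γ) ^ 2) := by gcongr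
    _ ≤ 144 * (1 / γ) ^ 4 + 144 * (1 / γ) ^ 2 * (144 * (1 / γ) ^ 2) := by gcongr; norm_num
    _ = 20880 * (1 / γ) ^ 4 := by ring

theorem iterationTime_le (hs : 0 ≤ s) (hγ : 0 < γ) (hγ1 : γ ≤ 1) :
    (iterationTime s γ : ℝ) ≤ 576 * (1 / γ / blockLen s γ) := by
  have hl := blockLen_pos s hγ
  calc (iterationTime s γ : ℝ) = numBlocks s γ * numTurns s γ := by
        rw [iterationTime, Nat.cast_mul]
    _ ≤ 16 / blockLen s γ ^ 2 * (36 * (blockLen s γ / γ)) := by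
        gcongr
        exacts [numBlocks_le hs hγ hγ1, numTurns_le s hγ]
    _ = 576 * (1 / γ / blockLen s γ) := by field_simp; norm_num

theorem discoveryTime_add_mul_iterationTime_le (hs : 0 ≤ s) (hγ : 0 < γ) (hγ1 : γ ≤ 1) (D : ℕ) :
    ((discoveryTime s γ + (D + 2) * iterationTime s γ : ℕ) : ℝ) ≤
      30000 * (D * (1 / γ) / blockLen s γ + (1 / γ) ^ 4) := by
  have hl := blockLen_pos s hγ
  have hg : 1 ≤ 1 / γ := (one_le_div hγ).2 hγ1
  have hgl : 1 / γ / blockLen s γ ≤ 2 * (1 / γ) ^ 4 :=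
    calc 1 / γ / blockLen s γ = 1 / γ * (1 / blockLen s γ) := by ring
      _ ≤ 1 / γ * (2 * (1 / γ)) := by gcongr; exact one_div_blockLen_le s hγ
      _ = 2 * (1 / γ) ^ 2 := by ring
      _ ≤ 2 * (1 / γ) ^ 4 := by gcongr; norm_num
  have hg4 : 0 ≤ (1 / γ) ^ 4 := by positivity
  have hD : 0 ≤ (D : ℝ) * (1 / γ / blockLen s γ) := by positivity
  calc ((discoveryTime s γ + (D + 2) * iterationTime s γ : ℕ) : ℝ)
      = discoveryTime s γ + (D + 2) * iterationTime s γ := by push_cast; rfl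
    _ ≤ 20880 * (1 / γ) ^ 4 + (D + 2) * (576 * (1 / γ / blockLen s γ)) := by
        gcongr
        exacts [discoveryTime_le hs hγ hγ1, iterationTime_le hs hγ hγ1]
    _ ≤ 30000 * (D * (1 / γ / blockLen s γ) + (1 / γ) ^ 4) := by
        generalize 1 / γ / blockLen s γ = x, (1 / γ) ^ 4 = y at hgl hD hg4 ⊢
        linarith
    _ = 30000 * (D * (1 / γ) / blockLen s γ + (1 / γ) ^ 4) := by ring

end RunningTime

end Swamping

theorem theorem4 :
    ∃ C : ℝ, 0 < C ∧
      ∀ (s γ : ℝ), 0 ≤ s → s < 1 → 0 < γ → γ ≤ 1 →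
      ∀ (V : Finset Swamping.Plane),
        (∀ u ∈ V, ∀ v ∈ V, u ≠ v → γ ≤ dist u v) →
        (Swamping.network s V).Connected →
      ∀ (M : Type*) (m : M) (src : V) (g l : ℝ),
        g = 1 / γ →
        l = max ((1 - s) / (3 * √2)) (γ / √2) →
        ∃ T : ℕ, Swamping.EndsAt s γ src m T ∧
          (∀ u : V, (Swamping.statesB2 s γ src m T u).msg = some m) ∧
          (T : ℝ) ≤ C * ((Swamping.network s V).diam * g / l + g ^ 4) := by
  refine ⟨30000, by norm_num, ?_⟩
  rintro s γ hs _ hγ hγ1 V hV hconn M m src g l rfl rfl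
  obtain ⟨T, hT, hinf, hle⟩ := Swamping.exists_endsAt src m hs hγ hγ1
    (fun u hu v hv huv => hV u hu v hv huv) hconn
  exact ⟨T, hT, hinf, (Nat.cast_le.2 hle).trans
    (Swamping.discoveryTime_add_mul_iterationTime_le hs hγ hγ1 _)⟩
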